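/- Let $K$ be a field, $n\ge 0$, and let $A_n=A_n(K)$ be the $n$-th Weyl algebra, i.e. the $K$-subalgebra of $\operatorname{End}_K(K[x_1,\dots,x_n])$ generated by the multiplications by $x_1,\dots,x_n$ and the partial derivatives $\partial_1,\dots,\partial_n$ (so $A_0=K$). For $r\in\mathbb N$ let $B_r$ be the $K$-span of all $x^\alpha\partial^\beta$ with $\alpha,\beta\in\mathbb N^n$, $|\alpha|+|\beta|\le r$. Modules are left modules. For a finitely generated $A_n$-module $M$ with a finite system of generators $f=(f_1,\dots,f_m)$, the Bernstein polynomial of $M$ associated with $f$ is the polynomial $\chi\in\mathbb Q[t]$ such that $\chi(r)=\dim_K\big(\sum_{i=1}^m B_r f_i\big)$ for all sufficiently large $r\in\mathbb N$. Put $\delta(M)=0$ if $\deg\chi<2n$ (in particular if $\chi=0$), and $\delta(M)=m(M)$ if $\deg\chi=2n$, where the multiplicity $m(M)$ is $d!$ times the coefficient of $t^d$ in $\chi$, with $d=\deg\chi$ (equivalently, the coefficient of $\binom{t+d}{d}$ when $\chi$ is written as $\sum_{i=0}^{d} a_i\binom{t+i}{i}$). Let $0\to N\xrightarrow{\,i\,}M\xrightarrow{\,j\,}P\to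 0$ be an exact sequence of finitely generated $A_n$-modules and $A_n$-linear maps. Then $\delta(N)$, $\delta(M)$ and $\delta(P)$ are well defined (for each of these modules and each of its finite systems of generators the Bernstein polynomial exists and has degree at most $2n$, and the value of $\delta$ does not depend on the system), and $$\delta(N)+\delta(P)=\delta(M).$$ -/

import Mathlib

open Polynomial

noncomputable section

namespace Weyl

/-- The `n`-th Weyl algebra `A_n(K)`: the `K`-subalgebra of `End_K (K[x_1, …, x_n])` generated by
the multiplications by the variables and the partial derivatives. -/
def weylSubalgebra (K : Type*) [Field K] (n : ℕ) :
    Subalgebra K (Module.End K (MvPolynomial (Fin n) K)) :=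
  Algebra.adjoin K
    (Set.range (fun i : Fin n => LinearMap.mulLeft K (MvPolynomial.X i : MvPolynomial (Fin n) K)) ∪
      Set.range (fun i : Fin n =>
        ((MvPolynomial.pderiv i :
          Derivation K (MvPolynomial (Fin n) K) (MvPolynomial (Fin n) K)) :
            MvPolynomial (Fin n) K →ₗ[K] MvPolynomial (Fin n) K)))

/-- The Weyl algebra as a ring. -/
abbrev WeylAlgebra (K : Type*) [Field K] (n : ℕ) : Type _ := weylSubalgebra K n

variable (K : Type*) [Field K] (n : ℕ)

/-- The generator `x_i` of `A_n(K)`. -/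
def xOp (i : Fin n) : WeylAlgebra K n :=
  ⟨LinearMap.mulLeft K (MvPolynomial.X i), Algebra.subset_adjoin (Or.inl ⟨i, rfl⟩)⟩

/-- The generator `∂_i` of `A_n(K)`. -/
def partialOp (i : Fin n) : WeylAlgebra K n :=
  ⟨(MvPolynomial.pderiv i : Derivation K (MvPolynomial (Fin n) K) (MvPolynomial (Fin n) K)),
    Algebra.subset_adjoin (Or.inr ⟨i, rfl⟩)⟩

/-- The monomial `x^α ∂^β = x_1^{α_1} ⋯ x_n^{α_n} ∂_1^{β_1} ⋯ ∂_n^{β_n}`. -/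
def weylMonomial (α β : Fin n → ℕ) : WeylAlgebra K n :=
  (List.ofFn fun i => xOp K n i ^ α i).prod * (List.ofFn fun i => partialOp K n i ^ β i).prod

/-- The `r`-th member `B_r` of the Bernstein filtration: the `K`-span of the monomials
`x^α ∂^β` with `|α| + |β| ≤ r`. -/
def bernsteinFiltration (r : ℕ) : Submodule K (WeylAlgebra K n) :=
  Submodule.span K
    {D | ∃ α β : Fin n → ℕ, (∑ i, α i) + (∑ i, β i) ≤ r ∧ D = weylMonomial K n α β}

section Modules

variable {M : Type*} [AddCommGroup M] [Module K M] [Module (WeylAlgebra K n) M]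
  [IsScalarTower K (WeylAlgebra K n) M]

/-- The `K`-subspace `M_r = ∑ i, B_r f_i` of `M`. -/
def generatedFiltration {m : ℕ} (f : Fin m → M) (r : ℕ) : Submodule K M :=
  ⨆ i, (bernsteinFiltration K n r).map
    ((LinearMap.toSpanSingleton (WeylAlgebra K n) M (f i)).restrictScalars K)

/-- `f_1, …, f_m` is a system of generators of the `A_n(K)`-module `M`. -/
def Generates {m : ℕ} (f : Fin m → M) : Prop :=
  Submodule.span (WeylAlgebra K n) (Set.range f) = ⊤

/-- `χ(r) = dim_K M_r` for all sufficiently large `r`, where `M_r = ∑ i, B_r f_i`. -/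
def IsBernsteinPolynomial {m : ℕ} (f : Fin m → M) (χ : ℚ[X]) : Prop :=
  ∃ r₀ : ℕ, ∀ r : ℕ, r₀ ≤ r →
    χ.eval (r : ℚ) = (Module.finrank K (generatedFiltration K n f r) : ℚ)

open Classical in
/-- The Bernstein polynomial associated with a system `f` (it is unique when it exists, since two
polynomials that agree at all large integers are equal). -/
def bernsteinDimPoly {m : ℕ} (f : Fin m → M) : ℚ[X] :=
  if h : ∃ χ : ℚ[X], IsBernsteinPolynomial K n f χ then h.choose else 0

end Modules

/-- The multiplicity read off from a polynomial `χ` of degree `d`: `d!` times the coefficient of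
`t ^ d`, i.e. the coefficient of `binom (t + d) d` when `χ` is written in the basis
`binom (t + i) i`. -/
def bernsteinMultiplicity (χ : ℚ[X]) : ℚ := (χ.natDegree.factorial : ℚ) * χ.leadingCoeff

/-- `0` if `deg χ < 2n` (in particular if `χ = 0`), and the multiplicity if `deg χ = 2n`. -/
def deltaPoly (χ : ℚ[X]) : ℚ :=
  if χ.degree < ((2 * n : ℕ) : WithBot ℕ) then 0 else bernsteinMultiplicity χ

/-- `δ(M)` of a finitely generated `A_n(K)`-module `M`, computed from the Bernstein polynomial
associated with some finite system of generators. -/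
def delta (M : Type*) [AddCommGroup M] [Module K M] [Module (WeylAlgebra K n) M]
    [IsScalarTower K (WeylAlgebra K n) M] [Module.Finite (WeylAlgebra K n) M] : ℚ :=
  deltaPoly n (bernsteinDimPoly K n
    (Module.Finite.exists_fin (R := WeylAlgebra K n) (M := M)).choose_spec.choose)

/-- The number `δ(M)` is meaningful and equal to `d`: every finite system of generators of `M` has
a Bernstein polynomial, of degree at most `2n`, and each of these polynomials gives the value
`d`. -/
def DeltaWellDefined (M : Type*) [AddCommGroup M] [Module K M] [Module (WeylAlgebra K n) M]
    [IsScalarTower K (WeylAlgebra K n) M] (d : ℚ) : Prop :=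
  ∀ (m : ℕ) (f : Fin m → M), Generates K n f →
    IsBernsteinPolynomial K n f (bernsteinDimPoly K n f) ∧
    (bernsteinDimPoly K n f).degree ≤ ((2 * n : ℕ) : WithBot ℕ) ∧
    deltaPoly n (bernsteinDimPoly K n f) = d

end Weyl

end

/-! The only input about $A_n$ is that $w_a = x^\alpha\partial^\beta$, with
$a=(\alpha,\beta)\in\mathbb N^{2n}$, spans $A_n$ and satisfies $w_aw_b = w_{a+b}$ + lower degree.
Linear independence of the monomials is never needed, so the characteristic of $K$ plays no role.

Existence: order the vectors $w_a f_i$ by degree first, compatibly with translation of exponents.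
The dimension of $M_r$ counts those of degree at most $r$ outside the span of their predecessors
(`finrank_span_image_eq_card`). For each $i$ their exponents form a lower set of $\mathbb N^{2n}$,
whose counting function is eventually a polynomial of degree at most $2n$
(`eventuallyPoly_degreeCount`). Hence $\delta$ is $(2n)!$ times the coefficient of $t^{2n}$, which
is linear in $\chi$ and insensitive to shifts of $r$. Two systems of generators give filtrations
that contain each other up to a shift, so $\delta$ does not depend on the system.

Additivity: a Gröbner basis argument gives finitely many generators $g$ of $N$ with $M_r\cap\ker
j\subseteq i(N_r)\subseteq M_{r+c}\cap\ker j$ (`exists_ker_inf_monomialFiltration_le`,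
`exists_generates_kernel`). With rank-nullity for $j$ on $M_r$, comparing coefficients of $t^{2n}$
gives both inequalities. -/

/-! ### Eventually polynomial functions and summation -/

section EventuallyPolynomial

/-- `h` agrees at all large integers with a polynomial of degree at most `k`. -/
def EventuallyPoly (k : ℕ) (h : ℕ → ℚ) : Prop :=
  ∃ p : ℚ[X], p.natDegree ≤ k ∧ ∃ r₀ : ℕ, ∀ r : ℕ, r₀ ≤ r → p.eval (r : ℚ) = h r

theorem EventuallyPoly.add {k : ℕ} {g h : ℕ → ℚ} (hg : EventuallyPoly k g)
    (hh : EventuallyPoly k h) : EventuallyPoly k (fun r => g r + h r) := by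
  obtain ⟨p, hp, r₁, h₁⟩ := hg
  obtain ⟨q, hq, r₂, h₂⟩ := hh
  refine ⟨p + q, natDegree_add_le_of_degree_le hp hq, max r₁ r₂, fun r hr => ?_⟩
  rw [eval_add, h₁ r (le_trans (le_max_left _ _) hr), h₂ r (le_trans (le_max_right _ _) hr)]

theorem EventuallyPoly.mono {k l : ℕ} {h : ℕ → ℚ} (hh : EventuallyPoly k h) (hkl : k ≤ l) :
    EventuallyPoly l h := by
  obtain ⟨p, hp, hr⟩ := hh
  exact ⟨p, hp.trans hkl, hr⟩

theorem EventuallyPoly.of_shift {k : ℕ} {h : ℕ → ℚ}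
    (hh : EventuallyPoly k (fun r => h (r + 1))) : EventuallyPoly k h := by
  obtain ⟨p, hp, r₀, hr⟩ := hh
  refine ⟨taylor (-1) p, by rwa [natDegree_taylor], r₀ + 1, fun r hr' => ?_⟩
  obtain ⟨s, rfl⟩ : ∃ s, r = s + 1 := ⟨r - 1, by omega⟩
  rw [taylor_eval]
  refine Eq.trans ?_ (hr s (by omega))
  push_cast
  congr 1
  ring

theorem EventuallyPoly.shift {k : ℕ} {h : ℕ → ℚ}
    (hh : EventuallyPoly k h) : EventuallyPoly k (fun r => h (r + 1)) := by
  obtain ⟨p, hp, r₀, hr⟩ := hh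
  refine ⟨taylor 1 p, by rwa [natDegree_taylor], r₀, fun r hr' => ?_⟩
  rw [taylor_eval]
  refine Eq.trans ?_ (hr (r + 1) (by omega))
  push_cast
  rfl

theorem eventuallyPoly_sum {k : ℕ} {ι : Type*} (s : Finset ι) (h : ι → ℕ → ℚ)
    (hh : ∀ i ∈ s, EventuallyPoly k (h i)) : EventuallyPoly k (fun r => ∑ i ∈ s, h i r) := by
  classical
  induction s using Finset.induction_on with
  | empty => exact ⟨0, by simp, 0, by simp⟩
  | insert i s hi ih =>
    simp only [Finset.sum_insert hi]
    exact (hh i (by simp)).add (ih fun j hj => hh j (by simp [hj]))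

theorem natDegree_bernoulli_le (n : ℕ) : (Polynomial.bernoulli n).natDegree ≤ n := by
  unfold Polynomial.bernoulli
  refine natDegree_sum_le_of_forall_le _ _ fun i _ => ?_
  exact (natDegree_monomial_le _).trans (by omega)

/-- Every polynomial is the forward difference of a polynomial of degree larger by at most one. -/
theorem exists_forward_difference_eq (p : ℚ[X]) :
    ∃ q : ℚ[X], q.natDegree ≤ p.natDegree + 1 ∧
      ∀ x : ℚ, q.eval (1 + x) - q.eval x = p.eval x := by
  -- Since $B_{i+1}(x+1)-B_{i+1}(x)=(i+1)x^i$, Bernoulli polynomials sum the monomials of $p$.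
  refine ⟨∑ i ∈ Finset.range (p.natDegree + 1),
    C (p.coeff i / (i + 1)) * Polynomial.bernoulli (i + 1), ?_, fun x => ?_⟩
  · refine natDegree_sum_le_of_forall_le _ _ fun i hi => ?_
    refine (natDegree_C_mul_le _ _).trans ((natDegree_bernoulli_le _).trans ?_)
    have := Finset.mem_range.1 hi
    omega
  · rw [eval_finsetSum, eval_finsetSum, ← Finset.sum_sub_distrib, eval_eq_sum_range]
    refine Finset.sum_congr rfl fun i _ => ?_
    rw [eval_mul, eval_mul, bernoulli_eval_one_add, eval_C, eval_C]
    have : (i : ℚ) + 1 ≠ 0 := by positivity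
    push_cast
    rw [← mul_sub, add_sub_cancel_left, ← mul_assoc, div_mul_cancel₀ _ this]

theorem EventuallyPoly.of_difference {k : ℕ} {h : ℕ → ℚ}
    (hh : EventuallyPoly k (fun r => h (r + 1) - h r)) : EventuallyPoly (k + 1) h := by
  obtain ⟨p, hp, r₀, hr⟩ := hh
  obtain ⟨q, hq, hqp⟩ := exists_forward_difference_eq p
  -- The constant makes both sides agree at $r_0$; equal differences do the rest.
  refine ⟨q + C (h r₀ - q.eval (r₀ : ℚ)), ?_, r₀, fun r hr' => ?_⟩
  · refine natDegree_add_le_of_degree_le (hq.trans (by omega)) (by simp)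
  · induction r, hr' using Nat.le_induction with
    | base => simp
    | succ r hr' ih =>
      have h₁ := hqp r
      rw [hr r hr'] at h₁
      simp only [eval_add, eval_C] at ih ⊢
      push_cast
      rw [add_comm (r : ℚ) 1]
      linarith

end EventuallyPolynomial

/-! ### Counting lattice points of lower sets -/

section LowerSets

/-- Dickson's lemma. -/
theorem exists_finite_minimal {k : ℕ} (E : Set (Fin k → ℕ)) :
    ∃ T : Finset (Fin k → ℕ), (∀ t ∈ T, t ∈ E) ∧ ∀ e ∈ E, ∃ t ∈ T, t ≤ e := by
  have hfin : {x | Minimal (· ∈ E) x}.Finite := by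
    -- Minimal elements form an antichain, and $\mathbb N^k$ is well-quasi-ordered.
    refine WellQuasiOrderedLE.finite_of_isAntichain ?_
    intro a ha b hb hab hle
    exact hab (le_antisymm hle (hb.2 ha.1 hle))
  refine ⟨hfin.toFinset, fun t ht => ?_, fun e he => ?_⟩
  · exact ((hfin.mem_toFinset).1 ht).1
  · obtain ⟨t, hte, ht⟩ := exists_minimal_le_of_wellFoundedLT (· ∈ E) e he
    exact ⟨t, hfin.mem_toFinset.2 ht, hte⟩

theorem finite_degree_le (k r : ℕ) : {a : Fin k → ℕ | ∑ i, a i ≤ r}.Finite := by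
  refine (Set.finite_Iic (fun _ : Fin k => r)).subset fun a ha i => ?_
  exact (Finset.single_le_sum (f := a) (fun _ _ => Nat.zero_le _) (Finset.mem_univ i)).trans ha

/-- The number of elements of `D` of degree at most `r`. -/
noncomputable def degreeCount {k : ℕ} (D : Set (Fin k → ℕ)) (r : ℕ) : ℕ :=
  {a | a ∈ D ∧ ∑ i, a i ≤ r}.ncard

/-- The translate of `D` by `-j` along the first axis. -/
def shiftSet {k : ℕ} (D : Set (Fin (k + 1) → ℕ)) (j : ℕ) : Set (Fin (k + 1) → ℕ) :=
  {a | Fin.cons (a 0 + j) (Fin.tail a) ∈ D}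

/-- The slice of `D` at height `j` along the first axis. -/
def sliceSet {k : ℕ} (D : Set (Fin (k + 1) → ℕ)) (j : ℕ) : Set (Fin k → ℕ) :=
  {a | Fin.cons j a ∈ D}

/-- Points with first coordinate zero form the slice; lowering a positive first coordinate by one
lands in the next shift and lowers the degree by one. -/
theorem degreeCount_shiftSet {k : ℕ} (D : Set (Fin (k + 1) → ℕ)) (j r : ℕ) :
    degreeCount (shiftSet D j) (r + 1) =
      degreeCount (sliceSet D j) (r + 1) + degreeCount (shiftSet D (j + 1)) r := by
  have key : {a | a ∈ shiftSet D j ∧ ∑ i, a i ≤ r + 1} =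
      (fun a : Fin k → ℕ => (Fin.cons 0 a : Fin (k + 1) → ℕ)) ''
          {a | a ∈ sliceSet D j ∧ ∑ i, a i ≤ r + 1} ∪
        (fun a : Fin (k + 1) → ℕ => (Fin.cons (a 0 + 1) (Fin.tail a) : Fin (k + 1) → ℕ)) ''
          {a | a ∈ shiftSet D (j + 1) ∧ ∑ i, a i ≤ r} := by
    ext a
    simp only [Set.mem_union, Set.mem_image, Set.mem_ofPred_eq, shiftSet, sliceSet]
    constructor
    · rintro ⟨ha, hr⟩
      rw [Fin.sum_univ_succ] at hr
      rcases h : a 0 with _ | m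
      · left
        refine ⟨Fin.tail a, ⟨?_, ?_⟩, ?_⟩
        · simpa [h] using ha
        · simpa [h, Fin.tail] using hr
        · rw [← h, Fin.cons_self_tail]
      · right
        refine ⟨Fin.cons m (Fin.tail a), ⟨?_, ?_⟩, ?_⟩
        · simp only [Fin.cons_zero, Fin.tail_cons]
          rw [h] at ha
          convert! ha using 2
          omega
        · rw [Fin.sum_univ_succ]
          simp only [Fin.cons_zero, Fin.cons_succ, Fin.tail]
          omega
        · simp only [Fin.cons_zero, Fin.tail_cons]
          rw [← h, Fin.cons_self_tail]
    · rintro (⟨b, ⟨hb, hr⟩, rfl⟩ | ⟨b, ⟨hb, hr⟩, rfl⟩)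
      · refine ⟨by simpa using hb, ?_⟩
        rw [Fin.sum_univ_succ]
        simpa using hr
      · refine ⟨?_, ?_⟩
        · simp only [Fin.cons_zero, Fin.tail_cons]
          convert! hb using 2
          omega
        · rw [Fin.sum_univ_succ] at hr ⊢
          simp only [Fin.cons_zero, Fin.cons_succ, Fin.tail]
          omega
  unfold degreeCount
  rw [key, Set.ncard_union_eq ?_
    (((finite_degree_le k (r + 1)).subset fun a ha => ha.2).image _)
    (((finite_degree_le (k + 1) r).subset fun a ha => ha.2).image _)]
  · congr 1
    · exact Set.ncard_image_of_injective _ fun a b hab => (Fin.cons_injective2 hab).2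
    · refine Set.ncard_image_of_injective _ fun a b hab => ?_
      obtain ⟨h₁, h₂⟩ := Fin.cons_injective2 hab
      rw [← Fin.cons_self_tail a, ← Fin.cons_self_tail b, h₂, Nat.succ_injective h₁]
  · rw [Set.disjoint_left]
    rintro _ ⟨a, -, rfl⟩ ⟨b, -, hb⟩
    have := congrFun hb 0
    simp at this

/-- The shifts decrease with $j$. By Dickson's lemma finitely many points $t$ lie below all points
that ever drop out; once all these $t$ have dropped out, nothing more can. -/
theorem exists_shiftSet_eq_succ {k : ℕ} (D : Set (Fin (k + 1) → ℕ)) (hD : IsLowerSet D) :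
    ∃ j, shiftSet D (j + 1) = shiftSet D j := by
  obtain ⟨T, hT, hmin⟩ := exists_finite_minimal {a : Fin (k + 1) → ℕ | ∃ j, a ∉ shiftSet D j}
  choose! J hJ using hT
  have anti : ∀ a b : Fin (k + 1) → ℕ, ∀ i j : ℕ, a ≤ b → i ≤ j →
      b ∈ shiftSet D j → a ∈ shiftSet D i := by
    intro a b i j hab hij hb
    refine hD ?_ hb
    refine Fin.cons_le_cons.2 ⟨?_, fun l => hab l.succ⟩
    exact add_le_add (hab 0) hij
  refine ⟨T.sup J, Set.Subset.antisymm (fun a ha => anti a a _ _ le_rfl (Nat.le_succ _) ha)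
    fun a ha => ?_⟩
  by_contra hna
  obtain ⟨t, ht, hta⟩ := hmin a ⟨_, hna⟩
  exact hJ t ht (anti t a _ _ hta (Finset.le_sup ht) ha)

theorem isLowerSet_sliceSet {k : ℕ} {D : Set (Fin (k + 1) → ℕ)} (hD : IsLowerSet D) (j : ℕ) :
    IsLowerSet (sliceSet D j) := fun _ _ hab ha => hD (Fin.cons_le_cons.2 ⟨le_rfl, hab⟩) ha

/-- The Hilbert function of a lower set of `ℕ ^ k` is eventually polynomial. -/
theorem eventuallyPoly_degreeCount {k : ℕ} (D : Set (Fin k → ℕ)) (hD : IsLowerSet D) :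
    EventuallyPoly k (fun r => (degreeCount D r : ℚ)) := by
  induction k with
  | zero =>
    refine ⟨C (D.ncard : ℚ), by simp, 0, fun r _ => ?_⟩
    simp [degreeCount]
  | succ k ih =>
    obtain ⟨j, hj⟩ := exists_shiftSet_eq_succ D hD
    have slice := fun i => (ih (sliceSet D i) (isLowerSet_sliceSet hD i)).shift
    -- At the stable height $j$ the count has a slice count as its difference, which costs one
    -- degree. Descending from $j$ to $0$ then only adds finitely many slices.
    have step : ∀ i, i ≤ j →
        EventuallyPoly (k + 1) (fun r => (degreeCount (shiftSet D i) r : ℚ)) := by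
      intro i hi
      induction hi using Nat.decreasingInduction with
      | self =>
        refine EventuallyPoly.of_difference ?_
        convert! slice j using 2 with r
        rw [degreeCount_shiftSet, hj]
        push_cast
        ring
      | of_succ i _ hs =>
        refine EventuallyPoly.of_shift ?_
        convert! ((slice i).mono (Nat.le_succ k)).add hs using 2 with r
        rw [degreeCount_shiftSet]
        push_cast
        ring
    convert! step 0 (Nat.zero_le _) using 4
    ext a
    simp [shiftSet]

end LowerSets

/-! ### Leading terms in an ordered spanning family -/

section Echelon

variable {K V W ι : Type*} [Field K] [AddCommGroup V] [Module K V] [AddCommGroup W] [Module K W]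
  [LinearOrder ι]

theorem eq_Iio_of_isLowerSet_insert {a : ι} {s : Finset ι} (hs : ∀ x ∈ s, x < a)
    (h : IsLowerSet ((insert a s : Finset ι) : Set ι)) : (s : Set ι) = Set.Iio a := by
  ext x
  refine ⟨fun hx => hs x hx, fun hx => ?_⟩
  have := h (le_of_lt hx) (by simp : a ∈ ((insert a s : Finset ι) : Set ι))
  rcases Finset.mem_insert.1 this with rfl | h
  · exact absurd hx (lt_irrefl _)
  · exact h

theorem isLowerSet_of_isLowerSet_insert {a : ι} {s : Finset ι} (hs : ∀ x ∈ s, x < a)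
    (h : IsLowerSet ((insert a s : Finset ι) : Set ι)) : IsLowerSet (s : Set ι) := by
  rw [eq_Iio_of_isLowerSet_insert hs h]
  exact isLowerSet_Iio a

open Classical in
/-- The dimension of the span of an initial segment of an ordered family is the number of members
that are not in the span of their predecessors. -/
theorem finrank_span_image_eq_card (u : ι → V) (I : Finset ι) (hI : IsLowerSet (I : Set ι)) :
    Module.finrank K (Submodule.span K (u '' I)) =
      (I.filter fun a => u a ∉ Submodule.span K (u '' Set.Iio a)).card := by
  induction I using Finset.induction_on_max with
  | empty =>
    rw [Finset.coe_empty, Set.image_empty, Submodule.span_empty, finrank_bot]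
    simp
  | insert a s hs ih =>
    have has : a ∉ s := fun h => lt_irrefl _ (hs a h)
    have hs' := eq_Iio_of_isLowerSet_insert hs hI
    have : FiniteDimensional K (Submodule.span K (u '' (s : Set ι))) :=
      FiniteDimensional.span_of_finite K (s.finite_toSet.image u)
    specialize ih (isLowerSet_of_isLowerSet_insert hs hI)
    rw [Finset.coe_insert, Set.image_insert_eq, Submodule.span_insert, sup_comm,
      Finset.filter_insert]
    split_ifs with h
    · rw [← ih, sup_eq_left.2]
      rw [← hs'] at h
      exact (Submodule.span_singleton_le_iff_mem _ _).2 h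
    · rw [Finset.card_insert_of_notMem (by simp [has]), ← ih]
      rw [← hs'] at h
      have hne : u a ≠ 0 := fun h₀ => h (h₀ ▸ Submodule.zero_mem _)
      have hinf := (Submodule.disjoint_span_singleton' hne).2 h
      have := Submodule.finrank_sup_add_finrank_inf_eq (Submodule.span K (u '' (s : Set ι)))
        (Submodule.span K {u a})
      rwa [hinf.eq_bot, finrank_bot, add_zero, finrank_span_singleton hne] at this

/-- If `Q` contains, for each member of an ordered family whose image under `φ` is in the span of
the previous images, an element with that leading term, then `Q` contains the kernel of `φ`. -/
theorem mem_of_exists_leadingTerm (u : ι → V) (φ : V →ₗ[K] W) (Q : Submodule K V)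
    (hQ : Q ≤ LinearMap.ker φ) (I : Finset ι) (hI : IsLowerSet (I : Set ι))
    (h : ∀ b ∈ I, φ (u b) ∈ Submodule.span K ((fun c => φ (u c)) '' Set.Iio b) →
      ∃ q ∈ Q, q - u b ∈ Submodule.span K (u '' Set.Iio b)) :
    ∀ v ∈ Submodule.span K (u '' I), φ v = 0 → v ∈ Q := by
  induction I using Finset.induction_on_max with
  | empty =>
    intro v hv _
    have : v = 0 := by simpa using hv
    rw [this]
    exact Q.zero_mem
  | insert a s hs ih =>
    have hs' := eq_Iio_of_isLowerSet_insert hs hI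
    specialize ih (isLowerSet_of_isLowerSet_insert hs hI)
      fun b hb => h b (Finset.mem_insert_of_mem hb)
    intro v hv hφ
    rw [Finset.coe_insert, Set.image_insert_eq] at hv
    obtain ⟨c, z, hz, rfl⟩ := Submodule.mem_span_insert.1 hv
    by_cases hc : c = 0
    · subst hc
      rw [zero_smul, zero_add] at hφ ⊢
      exact ih z hz hφ
    -- Solving $\varphi(c\,u_a+z)=0$ for $\varphi(u_a)$ shows that $u_a$ is a leading term allowed
    -- by `h`; subtracting $c\,q$ removes it.
    have hmem : φ (u a) ∈ Submodule.span K ((fun c => φ (u c)) '' Set.Iio a) := by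
      have h₁ : φ (u a) = φ (-(c⁻¹ • z)) := by
        rw [map_add, map_smul, add_eq_zero_iff_eq_neg] at hφ
        rw [map_neg, map_smul, ← smul_neg, ← hφ, inv_smul_smul₀ hc]
      rw [h₁, ← hs', ← Set.image_image φ u, ← Submodule.map_span]
      exact Submodule.mem_map_of_mem (Submodule.neg_mem _ (Submodule.smul_mem _ _ hz))
    obtain ⟨q, hqQ, hq⟩ := h a (Finset.mem_insert_self a s) hmem
    have hqφ : φ q = 0 := hQ hqQ
    have h₂ : c • u a + z - c • q ∈ Q := by
      refine ih _ ?_ (by rw [map_sub, hφ, map_smul, hqφ, smul_zero, sub_zero])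
      rw [← hs'] at hq
      have : c • u a + z - c • q = z - c • (q - u a) := by rw [smul_sub]; abel
      rw [this]
      exact Submodule.sub_mem _ hz (Submodule.smul_mem _ _ hq)
    have := Q.add_mem h₂ (Q.smul_mem c hqQ)
    rwa [sub_add_cancel] at this

end Echelon

/-! ### The graded order on the indices of $w_a f_i$ -/

section MonomialIndex

/-- Indices of the elements `w a • f i`. -/
@[ext]
structure MonomialIndex (k s : ℕ) where
  /-- The exponents `a`. -/
  exponent : Fin k → ℕ
  /-- The position `i`. -/
  position : Fin s

namespace MonomialIndex

variable {k s : ℕ}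

/-- The degree of the monomial. -/
def deg (b : MonomialIndex k s) : ℕ := ∑ i, b.exponent i

/-- Multiplication of the monomial by the monomial with exponents `a`. -/
def shift (a : Fin k → ℕ) (b : MonomialIndex k s) : MonomialIndex k s :=
  ⟨a + b.exponent, b.position⟩

/-- The sorting key: the degree, then the exponents, then the position. -/
def key (b : MonomialIndex k s) : ℕ ×ₗ (Lex (Fin k → ℕ) ×ₗ Fin s) :=
  toLex (b.deg, toLex (toLex b.exponent, b.position))

theorem key_injective : Function.Injective (key : MonomialIndex k s → _) := by
  intro b c h
  have h₁ := congrArg (fun x => (ofLex (ofLex x).2)) h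
  exact MonomialIndex.ext (congrArg (fun x : Lex (Fin k → ℕ) × Fin s => ofLex x.1) h₁)
    (congrArg (fun x : Lex (Fin k → ℕ) × Fin s => x.2) h₁)

/-- Degree is compared first so that error terms of lower degree precede the leading term and each
`degLE` is an initial segment. -/
noncomputable instance : LinearOrder (MonomialIndex k s) := LinearOrder.lift' key key_injective

theorem lt_iff {b c : MonomialIndex k s} :
    b < c ↔ b.deg < c.deg ∨ b.deg = c.deg ∧
      (toLex b.exponent < toLex c.exponent ∨
        toLex b.exponent = toLex c.exponent ∧ b.position < c.position) := by
  change key b < key c ↔ _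
  simp [key, Prod.Lex.toLex_lt_toLex]

theorem deg_shift (a : Fin k → ℕ) (b : MonomialIndex k s) :
    (shift a b).deg = ∑ i, a i + b.deg := by
  simp [shift, deg, Finset.sum_add_distrib]

theorem shift_lt_shift (a : Fin k → ℕ) {b c : MonomialIndex k s} (h : b < c) :
    shift a b < shift a c := by
  rw [lt_iff] at h ⊢
  simp only [deg_shift]
  have h₁ : toLex (shift a b).exponent = toLex a + toLex b.exponent := rfl
  have h₂ : toLex (shift a c).exponent = toLex a + toLex c.exponent := rfl
  have h₃ : (shift a b).position = b.position := rfl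
  have h₄ : (shift a c).position = c.position := rfl
  rw [h₁, h₂, h₃, h₄, add_lt_add_iff_left, add_lt_add_iff_left, add_right_inj, add_right_inj]
  exact h

theorem lt_of_deg_lt {b c : MonomialIndex k s} (h : b.deg < c.deg) : b < c :=
  lt_iff.2 (Or.inl h)

theorem deg_le_of_le {b c : MonomialIndex k s} (h : b ≤ c) : b.deg ≤ c.deg := by
  by_contra hlt
  exact absurd (lt_of_deg_lt (not_le.1 hlt)) (not_lt.2 h)

/-- Indices are pairs of exponents and a position. -/
def ofProd (k s : ℕ) : (Fin k → ℕ) × Fin s ↪ MonomialIndex k s :=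
  ⟨fun p => ⟨p.1, p.2⟩, fun _ _ h => Prod.ext (congrArg exponent h) (congrArg position h)⟩

/-- The indices of degree at most `r`. -/
noncomputable def degLE (k s r : ℕ) : Finset (MonomialIndex k s) :=
  ((finite_degree_le k r).toFinset ×ˢ Finset.univ).map (ofProd k s)

theorem mem_degLE {r : ℕ} {b : MonomialIndex k s} : b ∈ degLE k s r ↔ b.deg ≤ r := by
  rcases b with ⟨a, i⟩
  rw [degLE, Finset.mem_map]
  constructor
  · rintro ⟨⟨a', i'⟩, h, he⟩
    obtain ⟨rfl, rfl⟩ := MonomialIndex.mk.inj he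
    simpa [deg] using h
  · exact fun h => ⟨(a, i), by simpa [deg] using h, rfl⟩

theorem isLowerSet_degLE (r : ℕ) : IsLowerSet (degLE k s r : Set (MonomialIndex k s)) :=
  fun _ _ hba hb => mem_degLE.2 ((deg_le_of_le hba).trans (mem_degLE.1 hb))

theorem card_filter_degLE (p : MonomialIndex k s → Prop) [DecidablePred p] (r : ℕ) :
    ((degLE k s r).filter p).card = ∑ i : Fin s, degreeCount {a | p ⟨a, i⟩} r := by
  have h : ∀ i : Fin s, degreeCount {a | p ⟨a, i⟩} r =
      ∑ a ∈ (finite_degree_le k r).toFinset, if p ⟨a, i⟩ then 1 else 0 := by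
    intro i
    rw [← Finset.card_filter, ← Set.ncard_coe_finset]
    unfold degreeCount
    congr 1
    ext a
    simp [and_comm]
  rw [Finset.card_filter, degLE, Finset.sum_map, Finset.sum_product_right]
  simp only [h]
  rfl

end MonomialIndex

end MonomialIndex

/-! ### Hilbert functions and kernels for monomial families -/

section MonomialFiltration

open MonomialIndex

variable {K R : Type*} [Field K] [Ring R] [Algebra K R] {k : ℕ}

variable (K) in
/-- The family `w` of elements of `R` multiplies like monomials, up to terms of lower degree. -/
structure IsMonomialFamily (w : (Fin k → ℕ) → R) : Prop where
  one : w 0 = 1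
  mul : ∀ a b, w a * w b - w (a + b) ∈
    Submodule.span K (w '' {c | ∑ i, c i < ∑ i, a i + ∑ i, b i})

variable {M P : Type*} [AddCommGroup M] [Module K M] [Module R M] [IsScalarTower K R M]
  [AddCommGroup P] [Module K P] [Module R P] [IsScalarTower K R P]

theorem smul_mem_of_mem_span_right {S : Set M} {Q : Submodule K M} (x : R)
    (h : ∀ y ∈ S, x • y ∈ Q) {v : M} (hv : v ∈ Submodule.span K S) : x • v ∈ Q := by
  induction hv using Submodule.span_induction with
  | mem y hy => exact h y hy
  | zero => rw [smul_zero]; exact Q.zero_mem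
  | add y z _ _ hy hz => rw [smul_add]; exact Q.add_mem hy hz
  | smul c y _ hy => rw [smul_comm]; exact Q.smul_mem c hy

theorem smul_mem_of_mem_span_left {S : Set R} {Q : Submodule K M} (m : M)
    (h : ∀ y ∈ S, y • m ∈ Q) {x : R} (hx : x ∈ Submodule.span K S) : x • m ∈ Q := by
  induction hx using Submodule.span_induction with
  | mem y hy => exact h y hy
  | zero => rw [zero_smul]; exact Q.zero_mem
  | add y z _ _ hy hz => rw [add_smul]; exact Q.add_mem hy hz
  | smul c y _ hy => rw [smul_assoc]; exact Q.smul_mem c hy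

/-- The family of all `w a • f i`. -/
def monomialVector (w : (Fin k → ℕ) → R) {s : ℕ} (f : Fin s → M) (b : MonomialIndex k s) : M :=
  w b.exponent • f b.position

variable (K) in
/-- The span of all `w a • f i` with `a` of degree at most `r`. -/
def monomialFiltration (w : (Fin k → ℕ) → R) {s : ℕ} (f : Fin s → M) (r : ℕ) : Submodule K M :=
  Submodule.span K (monomialVector w f '' (degLE k s r : Set (MonomialIndex k s)))

instance (w : (Fin k → ℕ) → R) {s : ℕ} (f : Fin s → M) (r : ℕ) :
    FiniteDimensional K (monomialFiltration K w f r) :=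
  FiniteDimensional.span_of_finite K ((degLE k s r).finite_toSet.image _)

variable {w : (Fin k → ℕ) → R} {s : ℕ}

omit [Algebra K R] [IsScalarTower K R M] in
theorem smul_mem_monomialFiltration (f : Fin s → M) {a : Fin k → ℕ} {r : ℕ}
    (ha : ∑ i, a i ≤ r) (i : Fin s) : w a • f i ∈ monomialFiltration K w f r :=
  Submodule.subset_span ⟨⟨a, i⟩, mem_degLE.2 ha, rfl⟩

omit [Algebra K R] [IsScalarTower K R M] in
theorem monomialFiltration_mono (f : Fin s → M) {r t : ℕ} (h : r ≤ t) :
    monomialFiltration K w f r ≤ monomialFiltration K w f t :=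
  Submodule.span_mono (Set.image_mono fun _ hb => mem_degLE.2 ((mem_degLE.1 hb).trans h))

theorem map_monomialFiltration (f : Fin s → M) (j : M →ₗ[R] P) (r : ℕ) :
    (monomialFiltration K w f r).map (j.restrictScalars K) =
      monomialFiltration K w (fun i => j (f i)) r := by
  unfold monomialFiltration
  rw [Submodule.map_span, Set.image_image]
  congr 2
  ext b
  simp [monomialVector]

namespace IsMonomialFamily

variable (hw : IsMonomialFamily K w)
include hw

theorem smul_monomialVector (f : Fin s → M) (a : Fin k → ℕ) (b : MonomialIndex k s) :
    w a • monomialVector w f b - monomialVector w f (shift a b) ∈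
      Submodule.span K (monomialVector w f '' {c | c.deg < (shift a b).deg}) := by
  have h : w a • monomialVector w f b - monomialVector w f (shift a b) =
      (w a * w b.exponent - w (a + b.exponent)) • f b.position := by
    rw [sub_smul, mul_smul]
    rfl
  rw [h]
  refine smul_mem_of_mem_span_left _ ?_ (hw.mul a b.exponent)
  rintro _ ⟨c, hc, rfl⟩
  refine Submodule.subset_span ⟨⟨c, b.position⟩, ?_, rfl⟩
  change deg _ < _
  rw [deg_shift]
  exact hc

theorem smul_monomialVector_Iio (f : Fin s → M) (a : Fin k → ℕ) (b : MonomialIndex k s) :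
    w a • monomialVector w f b - monomialVector w f (shift a b) ∈
      Submodule.span K (monomialVector w f '' Set.Iio (shift a b)) :=
  Submodule.span_mono (Set.image_mono fun _ hc => lt_of_deg_lt hc) (hw.smul_monomialVector f a b)

theorem smul_mem_span_Iio (f : Fin s → M) (a : Fin k → ℕ) (b : MonomialIndex k s) {v : M}
    (hv : v ∈ Submodule.span K (monomialVector w f '' Set.Iio b)) :
    w a • v ∈ Submodule.span K (monomialVector w f '' Set.Iio (shift a b)) := by
  refine smul_mem_of_mem_span_right _ ?_ hv
  rintro _ ⟨c, hc, rfl⟩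
  have hlt : shift a c < shift a b := shift_lt_shift a hc
  have h₁ := Submodule.span_mono (R := K)
    (Set.image_mono (f := monomialVector w f) (Set.Iio_subset_Iio hlt.le))
    (hw.smul_monomialVector_Iio f a c)
  have h₂ : monomialVector w f (shift a c) ∈
      Submodule.span K (monomialVector w f '' Set.Iio (shift a b)) :=
    Submodule.subset_span ⟨_, hlt, rfl⟩
  have := Submodule.add_mem _ h₁ h₂
  rwa [sub_add_cancel] at this

/-- Multiplying a relation with leading index $b$ by $w_a$ gives one with leading index `shift a b`,
so redundancy passes to multiples and the irredundant exponents form a lower set. -/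
theorem mem_span_Iio_shift (f : Fin s → M) (a : Fin k → ℕ) (b : MonomialIndex k s)
    (hb : monomialVector w f b ∈ Submodule.span K (monomialVector w f '' Set.Iio b)) :
    monomialVector w f (shift a b) ∈
      Submodule.span K (monomialVector w f '' Set.Iio (shift a b)) := by
  have := Submodule.sub_mem _ (hw.smul_mem_span_Iio f a b hb) (hw.smul_monomialVector_Iio f a b)
  rwa [sub_sub_cancel] at this

/-- The dimensions of the members of the filtration are eventually polynomial. -/
theorem eventuallyPoly_finrank (f : Fin s → M) :
    EventuallyPoly k (fun r => (Module.finrank K (monomialFiltration K w f r) : ℚ)) := by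
  classical
  have h : ∀ r, (Module.finrank K (monomialFiltration K w f r) : ℚ) =
      ∑ i : Fin s, (degreeCount {a | monomialVector w f ⟨a, i⟩ ∉
        Submodule.span K (monomialVector w f '' Set.Iio ⟨a, i⟩)} r : ℚ) := by
    intro r
    unfold monomialFiltration
    rw [finrank_span_image_eq_card _ _ (isLowerSet_degLE r), card_filter_degLE]
    push_cast
    rfl
  simp only [h]
  refine eventuallyPoly_sum _ _ fun i _ => eventuallyPoly_degreeCount _ ?_
  intro b a hab hb ha
  refine hb ?_
  have := hw.mem_span_Iio_shift f (b - a) ⟨a, i⟩ ha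
  have e : shift (b - a) (⟨a, i⟩ : MonomialIndex k s) = ⟨b, i⟩ := by
    simp only [shift]
    rw [tsub_add_cancel_of_le hab]
  rwa [e] at this

theorem smul_mem_monomialFiltration_add (f : Fin s → M) (a : Fin k → ℕ) {r : ℕ} {v : M}
    (hv : v ∈ monomialFiltration K w f r) :
    w a • v ∈ monomialFiltration K w f (∑ i, a i + r) := by
  refine smul_mem_of_mem_span_right _ ?_ hv
  rintro _ ⟨b, hb, rfl⟩
  have hb' := mem_degLE.1 hb
  have h₁ := Submodule.span_mono (R := K) (Set.image_mono (f := monomialVector w f)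
    fun c (hc : c.deg < (shift a b).deg) => (mem_degLE.2 (hc.le.trans (by
      rw [deg_shift]; exact Nat.add_le_add_left hb' _)) : c ∈ degLE k s (∑ i, a i + r)))
    (hw.smul_monomialVector f a b)
  have h₂ : monomialVector w f (shift a b) ∈ monomialFiltration K w f (∑ i, a i + r) :=
    Submodule.subset_span ⟨_, mem_degLE.2 (by rw [deg_shift]; exact Nat.add_le_add_left hb' _), rfl⟩
  have := Submodule.add_mem _ h₁ h₂
  rwa [sub_add_cancel] at this

theorem monomialFiltration_le_add (f : Fin s → M) {t c : ℕ} (g : Fin t → M)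
    (hg : ∀ i, g i ∈ monomialFiltration K w f c) (r : ℕ) :
    monomialFiltration K w g r ≤ monomialFiltration K w f (r + c) := by
  refine Submodule.span_le.2 ?_
  rintro _ ⟨b, hb, rfl⟩
  exact monomialFiltration_mono f (Nat.add_le_add_right (mem_degLE.1 hb) c)
    (hw.smul_mem_monomialFiltration_add f b.exponent (hg b.position))

theorem exists_mem_monomialFiltration (hspan : Submodule.span K (Set.range w) = ⊤) (f : Fin s → M)
    {v : M} (hv : v ∈ Submodule.span R (Set.range f)) :
    ∃ r, v ∈ monomialFiltration K w f r := by
  have hsmul : ∀ x : R, ∀ v : M, (∃ r, v ∈ monomialFiltration K w f r) →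
      ∃ r, x • v ∈ monomialFiltration K w f r := by
    rintro x v ⟨r, hr⟩
    have hx : x ∈ Submodule.span K (Set.range w) := hspan ▸ Submodule.mem_top
    induction hx using Submodule.span_induction with
    | mem y hy =>
      obtain ⟨a, rfl⟩ := hy
      exact ⟨_, hw.smul_mem_monomialFiltration_add f a hr⟩
    | zero => exact ⟨0, by rw [zero_smul]; exact Submodule.zero_mem _⟩
    | add y z _ _ hy hz =>
      obtain ⟨p, hp⟩ := hy
      obtain ⟨q, hq⟩ := hz
      refine ⟨max p q, ?_⟩
      rw [add_smul]
      exact Submodule.add_mem _ (monomialFiltration_mono f (le_max_left _ _) hp)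
        (monomialFiltration_mono f (le_max_right _ _) hq)
    | smul c y _ hy =>
      obtain ⟨p, hp⟩ := hy
      exact ⟨p, by rw [smul_assoc]; exact Submodule.smul_mem _ _ hp⟩
  induction hv using Submodule.span_induction with
  | mem y hy =>
    obtain ⟨i, rfl⟩ := hy
    refine ⟨0, ?_⟩
    have := smul_mem_monomialFiltration (K := K) (w := w) f (a := 0) (r := 0) (by simp) i
    rwa [hw.one, one_smul] at this
  | zero => exact ⟨0, Submodule.zero_mem _⟩
  | add y z _ _ hy hz =>
    obtain ⟨p, hp⟩ := hy
    obtain ⟨q, hq⟩ := hz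
    exact ⟨max p q, Submodule.add_mem _ (monomialFiltration_mono f (le_max_left _ _) hp)
      (monomialFiltration_mono f (le_max_right _ _) hq)⟩
  | smul x y _ hy => exact hsmul x y hy

/-- If `g` lies in the submodule generated by `f`, the filtration defined by `g` is contained in a
shift of the one defined by `f`. -/
theorem exists_monomialFiltration_le (hspan : Submodule.span K (Set.range w) = ⊤) (f : Fin s → M)
    {t : ℕ} (g : Fin t → M) (hg : ∀ i, g i ∈ Submodule.span R (Set.range f)) :
    ∃ c, ∀ r, monomialFiltration K w g r ≤ monomialFiltration K w f (r + c) := by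
  choose c hc using fun i => hw.exists_mem_monomialFiltration hspan f (hg i)
  refine ⟨Finset.univ.sup c, hw.monomialFiltration_le_add f g fun i => ?_⟩
  exact monomialFiltration_mono f (Finset.le_sup (Finset.mem_univ i)) (hc i)

/-- The filtration induced on the kernel of `j` is contained in the filtration defined by a finite
system of elements of the kernel. -/
theorem exists_ker_inf_monomialFiltration_le (f : Fin s → M) (j : M →ₗ[R] P) :
    ∃ (t : ℕ) (g : Fin t → M), (∀ i, j (g i) = 0) ∧
      ∀ r, ∀ v ∈ monomialFiltration K w f r, j v = 0 → v ∈ monomialFiltration K w g r := by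
  let u := monomialVector w f
  -- The leading exponents, at position $i$, of elements of $\ker j$; the elements chosen over the
  -- finite sets `T i` act as a Gröbner basis.
  let E : Fin s → Set (Fin k → ℕ) := fun i =>
    {a | j (u ⟨a, i⟩) ∈ Submodule.span K ((fun c => j (u c)) '' Set.Iio ⟨a, i⟩)}
  choose T hT hmin using fun i => exists_finite_minimal (E i)
  have lead : ∀ x : Σ i, T i, ∃ q : M, j q = 0 ∧
      q - u ⟨x.2, x.1⟩ ∈ Submodule.span K (u '' Set.Iio ⟨x.2, x.1⟩) := by
    rintro ⟨i, a, ha⟩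
    have h : j (u ⟨a, i⟩) ∈ Submodule.span K ((fun c => j (u c)) '' Set.Iio ⟨a, i⟩) := hT i a ha
    have himage : (fun c => j (u c)) '' Set.Iio ⟨a, i⟩ =
      j.restrictScalars K '' (u '' Set.Iio ⟨a, i⟩) := (Set.image_image _ _ _).symm
    rw [himage, ← Submodule.map_span] at h
    obtain ⟨z, hz, hzj⟩ := h
    refine ⟨u ⟨a, i⟩ - z, ?_, ?_⟩
    · rw [map_sub, sub_eq_zero]
      exact hzj.symm
    · rw [sub_sub_cancel_left]
      exact Submodule.neg_mem _ hz
  choose q hq hlead using lead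
  let e := (Fintype.equivFin (Σ i, T i)).symm
  have hg : ∀ i, j (q (e i)) = 0 := fun i => hq _
  refine ⟨_, fun i => q (e i), hg, fun r => ?_⟩
  refine mem_of_exists_leadingTerm u (j.restrictScalars K) _ ?_ _ (isLowerSet_degLE r) ?_
  · refine Submodule.span_le.2 ?_
    rintro _ ⟨b, -, rfl⟩
    change j (w b.exponent • q (e b.position)) = 0
    rw [map_smul, hq, smul_zero]
  · rintro ⟨a, i⟩ hb hmem
    obtain ⟨t, ht, hta⟩ := hmin i a hmem
    have hshift : shift (a - t) (⟨t, i⟩ : MonomialIndex k s) = ⟨a, i⟩ := by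
      simp only [shift]
      rw [tsub_add_cancel_of_le hta]
    -- This multiple of a basis element has leading index $(a,i)$. As $|a-t|\le|a|\le r$, it lies in
    -- the $r$-th step for $g$, with no shift.
    refine ⟨w (a - t) • q ⟨i, t, ht⟩, ?_, ?_⟩
    · have hdeg : ∑ l, (a - t) l ≤ r :=
        (Finset.sum_le_sum fun l _ => Nat.sub_le _ _).trans (mem_degLE.1 hb)
      have := smul_mem_monomialFiltration (K := K) (w := w) (fun i => q (e i)) hdeg
        (e.symm ⟨i, t, ht⟩)
      simpa using this
    · have h₁ := hw.smul_mem_span_Iio f (a - t) ⟨t, i⟩ (hlead ⟨i, t, ht⟩)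
      have h₂ := hw.smul_monomialVector_Iio f (a - t) ⟨t, i⟩
      rw [hshift] at h₁ h₂
      have := Submodule.add_mem _ h₁ h₂
      rwa [smul_sub, sub_add_sub_cancel] at this

end IsMonomialFamily

end MonomialFiltration

/-! ### Induction on exponents -/

section ExponentInduction

theorem exponent_induction {k : ℕ} {p : (Fin k → ℕ) → Prop} (zero : p 0)
    (succ : ∀ a i, p a → p (a + Pi.single i 1)) (a : Fin k → ℕ) : p a := by
  induction h : ∑ i, a i generalizing a with
  | zero =>
    have : a = 0 := funext fun i => (Finset.sum_eq_zero_iff.1 h) i (Finset.mem_univ i)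
    rwa [this]
  | succ m ih =>
    obtain ⟨i, -, hi⟩ := Finset.exists_ne_zero_of_sum_ne_zero (h.trans_ne (Nat.succ_ne_zero m))
    have ha : a = (a - Pi.single i 1) + Pi.single i 1 := by
      refine (tsub_add_cancel_of_le ?_).symm
      intro l
      rcases eq_or_ne l i with rfl | hl
      · simpa using Nat.one_le_iff_ne_zero.2 hi
      · simp [hl]
    rw [ha]
    refine succ _ i (ih _ ?_)
    rw [ha] at h
    simp only [Pi.add_apply, Finset.sum_add_distrib, Finset.sum_pi_single', Finset.mem_univ,
      if_true] at h
    simpa using h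

theorem sum_add_single {k : ℕ} (a : Fin k → ℕ) (i : Fin k) :
    ∑ l, (a + Pi.single i 1 : Fin k → ℕ) l = ∑ l, a l + 1 := by
  simp [Finset.sum_add_distrib]

theorem prod_ofFn_pow_add_single {R : Type*} [Monoid R] {n : ℕ} (y : Fin n → R)
    (hy : ∀ i j, Commute (y i) (y j)) (a : Fin n → ℕ) (j : Fin n) :
    (List.ofFn fun i => y i ^ (a + Pi.single j 1 : Fin n → ℕ) i).prod =
      y j * (List.ofFn fun i => y i ^ a i).prod := by
  induction n with
  | zero => exact j.elim0
  | succ n ih =>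
    rw [List.ofFn_succ, List.ofFn_succ, List.prod_cons, List.prod_cons]
    cases j using Fin.cases with
    | zero => simp [pow_succ', mul_assoc]
    | succ j =>
      have h : (fun i : Fin n => y i.succ ^ (a + Pi.single j.succ 1 : Fin (n + 1) → ℕ) i.succ) =
          fun i : Fin n => y i.succ ^ ((fun l : Fin n => a l.succ) + Pi.single j 1 : Fin n → ℕ) i := by
        funext i
        congr 1
        simp [Pi.single_apply]
      rw [h, ih (fun i => y i.succ) (fun i j => hy _ _), ← mul_assoc, ← mul_assoc]
      congr 1
      have h₀ : (a + Pi.single j.succ 1 : Fin (n + 1) → ℕ) 0 = a 0 := by simp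
      rw [h₀]
      exact ((hy 0 j.succ).pow_left (a 0)).eq

end ExponentInduction

/-! ### Multiplying ordered monomials under the Weyl relations -/

section OrderedMonomials

/-- Two families of elements of a ring that satisfy the relations of the Weyl algebra. -/
structure WeylRelations {R : Type*} [Ring R] {n : ℕ} (x d : Fin n → R) : Prop where
  left_commute : ∀ i j, Commute (x i) (x j)
  right_commute : ∀ i j, Commute (d i) (d j)
  right_mul_left : ∀ i j, d i * x j = x j * d i + if i = j then 1 else 0

/-- The product `x_1 ^ α_1 ⋯ x_n ^ α_n d_1 ^ β_1 ⋯ d_n ^ β_n`. -/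
def orderedMonomial {R : Type*} [Ring R] {n : ℕ} (x d : Fin n → R) (α β : Fin n → ℕ) : R :=
  (List.ofFn fun i => x i ^ α i).prod * (List.ofFn fun i => d i ^ β i).prod

/-- The ordered monomials, indexed by the concatenation of `α` and `β`. -/
def orderedMonomialAppend {R : Type*} [Ring R] {n : ℕ} (x d : Fin n → R)
    (a : Fin (n + n) → ℕ) : R :=
  orderedMonomial x d (fun i => a (Fin.castAdd n i)) (fun i => a (Fin.natAdd n i))

variable {K R : Type*} [Field K] [Ring R] [Algebra K R] {n : ℕ} {x d : Fin n → R}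

theorem prod_ofFn_pow_zero (x : Fin n → R) :
    (List.ofFn fun i => x i ^ (0 : Fin n → ℕ) i).prod = 1 :=
  List.prod_eq_one fun y hy => by
    obtain ⟨i, rfl⟩ := (List.mem_ofFn' _ _).1 hy
    simp

theorem orderedMonomial_zero_left (β : Fin n → ℕ) :
    orderedMonomial x d 0 β = (List.ofFn fun i => d i ^ β i).prod := by
  rw [orderedMonomial, prod_ofFn_pow_zero, one_mul]

theorem orderedMonomial_zero_zero : orderedMonomial x d 0 0 = 1 := by
  rw [orderedMonomial_zero_left, prod_ofFn_pow_zero]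

theorem orderedMonomialAppend_append (α β : Fin n → ℕ) :
    orderedMonomialAppend x d (Fin.append α β) = orderedMonomial x d α β := by
  unfold orderedMonomialAppend
  congr 1 <;> funext i
  · exact Fin.append_left α β i
  · exact Fin.append_right α β i

theorem sum_append (α β : Fin n → ℕ) :
    ∑ i, Fin.append α β i = ∑ i, α i + ∑ i, β i := by
  rw [Fin.sum_univ_add]
  congr 1
  · exact Finset.sum_congr rfl fun i _ => Fin.append_left α β i
  · exact Finset.sum_congr rfl fun i _ => Fin.append_right α β i

variable (K x d) in
/-- The span of the ordered monomials of degree less than `r`. -/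
def monomialsBelow (r : ℕ) : Submodule K R :=
  Submodule.span K
    {D | ∃ α β : Fin n → ℕ, (∑ i, α i) + (∑ i, β i) < r ∧ D = orderedMonomial x d α β}

theorem orderedMonomial_mem_monomialsBelow {α β : Fin n → ℕ} {r : ℕ}
    (h : (∑ i, α i) + (∑ i, β i) < r) : orderedMonomial x d α β ∈ monomialsBelow K x d r :=
  Submodule.subset_span ⟨α, β, h, rfl⟩

theorem monomialsBelow_mono {r s : ℕ} (h : r ≤ s) :
    monomialsBelow K x d r ≤ monomialsBelow K x d s :=
  Submodule.span_mono fun _ ⟨α, β, hr, hD⟩ => ⟨α, β, hr.trans_le h, hD⟩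

namespace WeylRelations

variable (hR : WeylRelations x d)
include hR

theorem left_mul_orderedMonomial (i : Fin n) (α β : Fin n → ℕ) :
    x i * orderedMonomial x d α β = orderedMonomial x d (α + Pi.single i 1) β := by
  unfold orderedMonomial
  rw [prod_ofFn_pow_add_single _ hR.left_commute, mul_assoc]

theorem right_mul_orderedMonomial_zero (i : Fin n) (β : Fin n → ℕ) :
    d i * orderedMonomial x d 0 β = orderedMonomial x d 0 (β + Pi.single i 1) := by
  rw [orderedMonomial_zero_left, orderedMonomial_zero_left,
    prod_ofFn_pow_add_single _ hR.right_commute]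

theorem left_mul_mem_monomialsBelow (i : Fin n) {r : ℕ} {D : R}
    (hD : D ∈ monomialsBelow K x d r) : x i * D ∈ monomialsBelow K x d (r + 1) := by
  refine smul_mem_of_mem_span_right (x i) ?_ hD
  rintro _ ⟨α, β, h, rfl⟩
  rw [smul_eq_mul, hR.left_mul_orderedMonomial]
  refine orderedMonomial_mem_monomialsBelow ?_
  rw [sum_add_single]
  omega

variable (K) in
-- Moving $d_i$ past one factor $x_j$ costs a commutator $0$ or $1$, hence only terms two degrees
-- lower.
theorem right_mul_orderedMonomial (i : Fin n) (α β : Fin n → ℕ) :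
    d i * orderedMonomial x d α β - orderedMonomial x d α (β + Pi.single i 1) ∈
      monomialsBelow K x d ((∑ i, α i) + (∑ i, β i) + 1) := by
  induction α using exponent_induction with
  | zero =>
    rw [hR.right_mul_orderedMonomial_zero, sub_self]
    exact Submodule.zero_mem _
  | succ α j ih =>
    have h : d i * orderedMonomial x d (α + Pi.single j 1) β -
        orderedMonomial x d (α + Pi.single j 1) (β + Pi.single i 1) =
        x j * (d i * orderedMonomial x d α β - orderedMonomial x d α (β + Pi.single i 1)) +
        if i = j then orderedMonomial x d α β else 0 := by
      rw [← hR.left_mul_orderedMonomial, ← hR.left_mul_orderedMonomial, ← mul_assoc,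
        hR.right_mul_left, add_mul, mul_sub, mul_assoc, ite_mul, one_mul, zero_mul]
      abel
    rw [h, sum_add_single]
    refine Submodule.add_mem _ ?_ ?_
    · exact monomialsBelow_mono (by omega) (hR.left_mul_mem_monomialsBelow j ih)
    · split_ifs
      · exact orderedMonomial_mem_monomialsBelow (by omega)
      · exact Submodule.zero_mem _

theorem right_mul_mem_monomialsBelow (i : Fin n) {r : ℕ} {D : R}
    (hD : D ∈ monomialsBelow K x d r) : d i * D ∈ monomialsBelow K x d (r + 1) := by
  refine smul_mem_of_mem_span_right (d i) ?_ hD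
  rintro _ ⟨α, β, h, rfl⟩
  have h₁ := hR.right_mul_orderedMonomial K i α β
  have h₂ : orderedMonomial x d α (β + Pi.single i 1) ∈ monomialsBelow K x d (r + 1) :=
    orderedMonomial_mem_monomialsBelow (by rw [sum_add_single]; omega)
  have := Submodule.add_mem _ (monomialsBelow_mono (by omega) h₁) h₂
  rwa [sub_add_cancel] at this

variable (K) in
-- The left factor is built up by multiplying on the left, by the $d_j$ first and then by the $x_j$;
-- only the $d_j$ create new errors.
theorem orderedMonomial_mul_orderedMonomial (α β γ δ : Fin n → ℕ) :
    orderedMonomial x d α β * orderedMonomial x d γ δ - orderedMonomial x d (α + γ) (β + δ) ∈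
      monomialsBelow K x d ((∑ i, α i) + (∑ i, β i) + ((∑ i, γ i) + (∑ i, δ i))) := by
  induction α using exponent_induction with
  | zero =>
    induction β using exponent_induction with
    | zero =>
      rw [orderedMonomial_zero_zero, one_mul, zero_add, zero_add, sub_self]
      exact Submodule.zero_mem _
    | succ β j ih =>
      have h := hR.right_mul_mem_monomialsBelow j ih
      rw [zero_add] at h ⊢
      have h₁ := hR.right_mul_orderedMonomial K j γ (β + δ)
      rw [mul_sub, ← mul_assoc, hR.right_mul_orderedMonomial_zero] at h
      have h₂ := Submodule.add_mem _ h (monomialsBelow_mono (by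
        simp only [Pi.add_apply, Finset.sum_add_distrib]
        omega) h₁)
      rw [sub_add_sub_cancel, add_right_comm β] at h₂
      refine monomialsBelow_mono ?_ h₂
      rw [sum_add_single]
      omega
  | succ α j ih =>
    have h := hR.left_mul_mem_monomialsBelow j ih
    rw [mul_sub, ← mul_assoc, hR.left_mul_orderedMonomial, hR.left_mul_orderedMonomial,
      add_right_comm α] at h
    refine monomialsBelow_mono ?_ h
    rw [sum_add_single]
    omega

variable (K) in
theorem isMonomialFamily : IsMonomialFamily K (orderedMonomialAppend x d) where
  one := orderedMonomial_zero_zero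
  mul a b := by
    have h := hR.orderedMonomial_mul_orderedMonomial K
      (fun i => a (Fin.castAdd n i)) (fun i => a (Fin.natAdd n i))
      (fun i => b (Fin.castAdd n i)) (fun i => b (Fin.natAdd n i))
    rw [← Fin.sum_univ_add, ← Fin.sum_univ_add] at h
    refine Submodule.span_mono ?_ h
    rintro _ ⟨α, β, h, rfl⟩
    exact ⟨Fin.append α β, (sum_append α β).trans_lt h, orderedMonomialAppend_append α β⟩

variable (K) in
/-- The span of the ordered monomials contains the subalgebra generated by the two families. -/
theorem toSubmodule_adjoin_le_span :
    Subalgebra.toSubmodule (Algebra.adjoin K (Set.range x ∪ Set.range d)) ≤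
      Submodule.span K (Set.range (orderedMonomialAppend x d)) := by
  have mem : ∀ α β, orderedMonomial x d α β ∈
      Submodule.span K (Set.range (orderedMonomialAppend x d)) := fun α β =>
    Submodule.subset_span ⟨_, orderedMonomialAppend_append α β⟩
  have one_mem : (1 : R) ∈ Submodule.span K (Set.range (orderedMonomialAppend x d)) := by
    rw [← orderedMonomial_zero_zero (x := x) (d := d)]
    exact mem 0 0
  intro D hD
  induction hD using Algebra.adjoin_induction with
  | mem D hD =>
    rcases hD with ⟨i, rfl⟩ | ⟨i, rfl⟩
    · have := mem (0 + Pi.single i 1) 0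
      rwa [← hR.left_mul_orderedMonomial, orderedMonomial_zero_zero, mul_one] at this
    · have := mem 0 (0 + Pi.single i 1)
      rwa [← hR.right_mul_orderedMonomial_zero, orderedMonomial_zero_zero, mul_one] at this
  | algebraMap c =>
    have := Submodule.smul_mem _ c one_mem
    rwa [← Algebra.algebraMap_eq_smul_one] at this
  | add D E _ _ hD hE => exact Submodule.add_mem _ hD hE
  | mul D E _ _ hD hE =>
    refine smul_mem_of_mem_span_left E ?_ hD
    rintro _ ⟨a, rfl⟩
    refine smul_mem_of_mem_span_right _ ?_ hE
    rintro _ ⟨b, rfl⟩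
    have h := Submodule.span_mono (R := K) (Set.image_subset_range _ _)
      ((hR.isMonomialFamily K).mul a b)
    have := Submodule.add_mem _ h (Submodule.subset_span ⟨a + b, rfl⟩)
    rwa [sub_add_cancel] at this

end WeylRelations

end OrderedMonomials

/-! ### The Weyl algebra as a monomial family -/

namespace Weyl

variable {K : Type*} [Field K] {n : ℕ}

theorem pderiv_commute (i j : Fin n) (p : MvPolynomial (Fin n) K) :
    MvPolynomial.pderiv i (MvPolynomial.pderiv j p) =
      MvPolynomial.pderiv j (MvPolynomial.pderiv i p) := by
  have h : ⁅(MvPolynomial.pderiv i :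
        Derivation K (MvPolynomial (Fin n) K) (MvPolynomial (Fin n) K)),
      (MvPolynomial.pderiv j :
        Derivation K (MvPolynomial (Fin n) K) (MvPolynomial (Fin n) K))⁆ = 0 := by
    -- The commutator is again a derivation, so it suffices that it kills the variables.
    refine MvPolynomial.derivation_ext fun l => ?_
    rw [Derivation.commutator_apply, MvPolynomial.pderiv_X, MvPolynomial.pderiv_X,
      Pi.single_apply, Pi.single_apply]
    split_ifs <;> simp
  have := congrArg (fun D => D p) h
  rw [Derivation.commutator_apply] at this
  exact sub_eq_zero.1 this

theorem pderiv_X_mul (i j : Fin n) (p : MvPolynomial (Fin n) K) :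
    MvPolynomial.pderiv i (MvPolynomial.X j * p) =
      MvPolynomial.X j * MvPolynomial.pderiv i p + if i = j then p else 0 := by
  rw [Derivation.leibniz, MvPolynomial.pderiv_X, smul_eq_mul, smul_eq_mul]
  congr 1
  rcases eq_or_ne i j with rfl | hij
  · simp
  · simp [hij]

variable (K n) in
theorem weylRelations : WeylRelations (xOp K n) (partialOp K n) where
  left_commute i j := Subtype.ext (LinearMap.ext fun p =>
    mul_left_comm (MvPolynomial.X i) (MvPolynomial.X j) p)
  right_commute i j := Subtype.ext (LinearMap.ext fun p => pderiv_commute i j p)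
  right_mul_left i j := by
    refine Subtype.ext (LinearMap.ext fun p => (pderiv_X_mul i j p).trans ?_)
    split_ifs <;> rfl

variable (K n) in
/-- The monomials `x^α ∂^β`, indexed by the concatenation of `α` and `β`. -/
noncomputable def weylMonomialAppend (a : Fin (n + n) → ℕ) : WeylAlgebra K n :=
  orderedMonomialAppend (xOp K n) (partialOp K n) a

theorem weylMonomialAppend_append (α β : Fin n → ℕ) :
    weylMonomialAppend K n (Fin.append α β) = weylMonomial K n α β :=
  orderedMonomialAppend_append α β

theorem isMonomialFamily_weylMonomialAppend : IsMonomialFamily K (weylMonomialAppend K n) :=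
  (weylRelations K n).isMonomialFamily K

theorem adjoin_range_xOp_union_range_partialOp :
    Algebra.adjoin K (Set.range (xOp K n) ∪ Set.range (partialOp K n)) =
      (⊤ : Subalgebra K (WeylAlgebra K n)) := by
  have h := Algebra.adjoin_adjoin_coe_preimage (R := K)
    (s := Set.range (fun i : Fin n =>
        LinearMap.mulLeft K (MvPolynomial.X i : MvPolynomial (Fin n) K)) ∪
      Set.range (fun i : Fin n =>
        ((MvPolynomial.pderiv i :
          Derivation K (MvPolynomial (Fin n) K) (MvPolynomial (Fin n) K)) :
            MvPolynomial (Fin n) K →ₗ[K] MvPolynomial (Fin n) K)))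
  refine eq_top_iff.2 (h.ge.trans (Algebra.adjoin_mono ?_))
  rintro D (⟨i, hi⟩ | ⟨i, hi⟩)
  · exact Or.inl ⟨i, Subtype.ext hi⟩
  · exact Or.inr ⟨i, Subtype.ext hi⟩

theorem span_range_weylMonomialAppend :
    Submodule.span K (Set.range (weylMonomialAppend K n)) = ⊤ := by
  refine eq_top_iff.2 fun D _ => (weylRelations K n).toSubmodule_adjoin_le_span K ?_
  have h := adjoin_range_xOp_union_range_partialOp (K := K) (n := n)
  rw [h]
  exact Algebra.mem_top (R := K)

variable {M : Type*} [AddCommGroup M] [Module K M] [Module (WeylAlgebra K n) M]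
  [IsScalarTower K (WeylAlgebra K n) M]

theorem generatedFiltration_eq {m : ℕ} (f : Fin m → M) (r : ℕ) :
    generatedFiltration K n f r = monomialFiltration K (weylMonomialAppend K n) f r := by
  refine le_antisymm (iSup_le fun i => Submodule.map_le_iff_le_comap.2 (Submodule.span_le.2 ?_))
    (Submodule.span_le.2 ?_)
  · rintro _ ⟨α, β, h, rfl⟩
    have := smul_mem_monomialFiltration (K := K) (w := weylMonomialAppend K n) f
      (a := Fin.append α β) (r := r) ((sum_append α β).trans_le h) i
    rwa [weylMonomialAppend_append] at this
  · rintro _ ⟨b, hb, rfl⟩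
    refine Submodule.mem_iSup_of_mem b.position ⟨weylMonomialAppend K n b.exponent, ?_, rfl⟩
    have h := MonomialIndex.mem_degLE.1 hb
    rw [MonomialIndex.deg, Fin.sum_univ_add] at h
    exact Submodule.subset_span ⟨_, _, h, rfl⟩

end Weyl

/-! ### Comparing top coefficients -/

section LeadingCoefficients

theorem coeff_nonneg_of_eventually_eval_nonneg {k : ℕ} {p : ℚ[X]} (hp : p.natDegree ≤ k)
    {r₀ : ℕ} (h : ∀ r : ℕ, r₀ ≤ r → 0 ≤ p.eval (r : ℚ)) : 0 ≤ p.coeff k := by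
  by_contra! hneg
  have hk : p.natDegree = k := le_antisymm hp (le_natDegree_of_ne_zero hneg.ne)
  have hlead : p.leadingCoeff < 0 := by rwa [leadingCoeff, hk]
  rcases Nat.eq_zero_or_pos k with rfl | hpos
  · rw [eq_C_of_natDegree_eq_zero hk] at h
    have := h r₀ le_rfl
    rw [eval_C] at this
    linarith
  · have ht := (p.tendsto_atBot_of_leadingCoeff_nonpos
      (natDegree_pos_iff_degree_pos.1 (hk ▸ hpos)) hlead.le).comp
      (tendsto_natCast_atTop_atTop (R := ℚ))
    obtain ⟨r, hr, hr'⟩ := ((ht.eventually_lt_atBot 0).and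
      (Filter.eventually_ge_atTop r₀)).exists
    exact absurd (h r hr') (not_le.2 hr)

theorem coeff_taylor_of_natDegree_le {k : ℕ} {p : ℚ[X]} (hp : p.natDegree ≤ k) (c : ℚ) :
    (taylor c p).coeff k = p.coeff k := by
  rcases hp.lt_or_eq with h | rfl
  · rw [coeff_eq_zero_of_natDegree_lt h,
      coeff_eq_zero_of_natDegree_lt (by rwa [natDegree_taylor])]
  · exact coeff_taylor_natDegree _ _

/-- Translating $q$ by $c$ preserves its coefficient of $t^k$, so a bounded shift of the filtration
is harmless. -/
theorem coeff_le_coeff_of_eventually_eval_le {k : ℕ} {p q : ℚ[X]} (hp : p.natDegree ≤ k)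
    (hq : q.natDegree ≤ k) (c : ℕ) {r₀ : ℕ}
    (h : ∀ r : ℕ, r₀ ≤ r → p.eval (r : ℚ) ≤ q.eval ((r + c : ℕ) : ℚ)) :
    p.coeff k ≤ q.coeff k := by
  have hd : (taylor (c : ℚ) q - p).natDegree ≤ k :=
    (natDegree_sub_le_of_le ((natDegree_taylor q (c : ℚ)).trans_le hq) hp).trans_eq (max_self k)
  have := coeff_nonneg_of_eventually_eval_nonneg hd (r₀ := r₀) fun r hr => by
    have := h r hr
    push_cast at this
    rw [eval_sub, taylor_eval]
    linarith
  rw [coeff_sub, coeff_taylor_of_natDegree_le hq] at this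
  linarith

end LeadingCoefficients

theorem finrank_map_add_finrank_ker_inf {K V W : Type*} [Field K] [AddCommGroup V] [Module K V]
    [AddCommGroup W] [Module K W] (φ : V →ₗ[K] W) (F : Submodule K V) [FiniteDimensional K F] :
    Module.finrank K (F.map φ) + Module.finrank K (F ⊓ LinearMap.ker φ : Submodule K V) =
      Module.finrank K F := by
  rw [← LinearMap.finrank_range_add_finrank_ker (φ.domRestrict F), LinearMap.range_domRestrict,
    LinearMap.ker_domRestrict, ← Submodule.map_comap_subtype, Submodule.finrank_map_subtype_eq]

/-! ### The invariant $\delta$ and its independence of generators -/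

namespace Weyl

variable {K : Type*} [Field K] {n : ℕ}

/-- In degree below $2n$ the coefficient vanishes, so one linear formula covers both cases. -/
theorem deltaPoly_eq_factorial_mul_coeff {χ : ℚ[X]} (h : χ.natDegree ≤ 2 * n) :
    deltaPoly n χ = ((2 * n).factorial : ℚ) * χ.coeff (2 * n) := by
  unfold deltaPoly
  split_ifs with hlt
  · rw [coeff_eq_zero_of_degree_lt hlt, mul_zero]
  · have : χ.natDegree = 2 * n :=
      le_antisymm h (le_natDegree_of_coe_le_degree (not_lt.1 hlt))
    rw [bernsteinMultiplicity, leadingCoeff, this]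

section

variable {M : Type*} [AddCommGroup M] [Module K M] [Module (WeylAlgebra K n) M]
  [IsScalarTower K (WeylAlgebra K n) M]

instance {m : ℕ} (f : Fin m → M) (r : ℕ) : FiniteDimensional K (generatedFiltration K n f r) := by
  rw [generatedFiltration_eq]
  infer_instance

theorem IsBernsteinPolynomial.unique {m : ℕ} {f : Fin m → M} {χ ψ : ℚ[X]}
    (hχ : IsBernsteinPolynomial K n f χ) (hψ : IsBernsteinPolynomial K n f ψ) : χ = ψ := by
  obtain ⟨r₁, h₁⟩ := hχ
  obtain ⟨r₂, h₂⟩ := hψ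
  refine eq_of_infinite_eval_eq χ ψ ?_
  refine Set.Infinite.mono ?_ ((Set.Ici_infinite (max r₁ r₂)).image
    (f := fun r : ℕ => (r : ℚ)) Nat.cast_injective.injOn)
  rintro _ ⟨r, hr, rfl⟩
  exact (h₁ r (le_trans (le_max_left _ _) hr)).trans (h₂ r (le_trans (le_max_right _ _) hr)).symm

theorem exists_isBernsteinPolynomial {m : ℕ} (f : Fin m → M) :
    ∃ χ : ℚ[X], IsBernsteinPolynomial K n f χ ∧ χ.natDegree ≤ 2 * n := by
  obtain ⟨χ, hχ, r₀, h⟩ :=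
    isMonomialFamily_weylMonomialAppend (K := K) (n := n).eventuallyPoly_finrank f
  refine ⟨χ, ⟨r₀, fun r hr => ?_⟩, by omega⟩
  rw [h r hr, generatedFiltration_eq]

theorem isBernsteinPolynomial_bernsteinDimPoly {m : ℕ} (f : Fin m → M) :
    IsBernsteinPolynomial K n f (bernsteinDimPoly K n f) := by
  obtain ⟨χ, hχ, -⟩ := exists_isBernsteinPolynomial (K := K) (n := n) f
  have h : ∃ χ : ℚ[X], IsBernsteinPolynomial K n f χ := ⟨χ, hχ⟩
  rw [bernsteinDimPoly, dif_pos h]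
  exact h.choose_spec

theorem natDegree_bernsteinDimPoly_le {m : ℕ} (f : Fin m → M) :
    (bernsteinDimPoly K n f).natDegree ≤ 2 * n := by
  obtain ⟨χ, hχ, hdeg⟩ := exists_isBernsteinPolynomial (K := K) (n := n) f
  rwa [(isBernsteinPolynomial_bernsteinDimPoly f).unique hχ]

theorem coeff_bernsteinDimPoly_le {m t : ℕ} {f : Fin m → M} (hf : Generates K n f)
    (g : Fin t → M) :
    (bernsteinDimPoly K n g).coeff (2 * n) ≤ (bernsteinDimPoly K n f).coeff (2 * n) := by
  obtain ⟨c, hc⟩ := isMonomialFamily_weylMonomialAppend.exists_monomialFiltration_le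
    span_range_weylMonomialAppend f g
    fun i => (show Submodule.span (WeylAlgebra K n) (Set.range f) = ⊤ from hf) ▸ Submodule.mem_top
  obtain ⟨r₁, h₁⟩ := isBernsteinPolynomial_bernsteinDimPoly (K := K) (n := n) f
  obtain ⟨r₂, h₂⟩ := isBernsteinPolynomial_bernsteinDimPoly (K := K) (n := n) g
  refine coeff_le_coeff_of_eventually_eval_le (natDegree_bernsteinDimPoly_le g)
    (natDegree_bernsteinDimPoly_le f) c (r₀ := max r₁ r₂) fun r hr => ?_
  rw [h₂ r (le_trans (le_max_right _ _) hr),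
    h₁ (r + c) ((le_trans (le_max_left _ _) hr).trans (Nat.le_add_right _ _)),
    generatedFiltration_eq, generatedFiltration_eq]
  exact_mod_cast Submodule.finrank_mono (hc r)

theorem coeff_bernsteinDimPoly_eq {m t : ℕ} {f : Fin m → M} {g : Fin t → M}
    (hf : Generates K n f) (hg : Generates K n g) :
    (bernsteinDimPoly K n f).coeff (2 * n) = (bernsteinDimPoly K n g).coeff (2 * n) :=
  le_antisymm (coeff_bernsteinDimPoly_le hg f) (coeff_bernsteinDimPoly_le hf g)

theorem delta_eq [Module.Finite (WeylAlgebra K n) M] {m : ℕ} {f : Fin m → M}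
    (hf : Generates K n f) :
    delta K n M = ((2 * n).factorial : ℚ) * (bernsteinDimPoly K n f).coeff (2 * n) := by
  rw [delta, deltaPoly_eq_factorial_mul_coeff (natDegree_bernsteinDimPoly_le _)]
  congr 1
  exact coeff_bernsteinDimPoly_eq
    (Module.Finite.exists_fin (R := WeylAlgebra K n) (M := M)).choose_spec.choose_spec hf

variable (K n M) in
theorem deltaWellDefined_delta [Module.Finite (WeylAlgebra K n) M] :
    DeltaWellDefined K n M (delta K n M) := by
  intro m f hf
  refine ⟨isBernsteinPolynomial_bernsteinDimPoly f,
    natDegree_le_iff_degree_le.1 (natDegree_bernsteinDimPoly_le f), ?_⟩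
  rw [deltaPoly_eq_factorial_mul_coeff (natDegree_bernsteinDimPoly_le f), delta_eq hf]

end

/-! ### Additivity along exact sequences -/

section Exact

variable {N M P : Type*}
  [AddCommGroup N] [Module K N] [Module (WeylAlgebra K n) N] [IsScalarTower K (WeylAlgebra K n) N]
  [AddCommGroup M] [Module K M] [Module (WeylAlgebra K n) M] [IsScalarTower K (WeylAlgebra K n) M]
  [AddCommGroup P] [Module K P] [Module (WeylAlgebra K n) P] [IsScalarTower K (WeylAlgebra K n) P]

theorem map_generatedFiltration {m : ℕ} (f : Fin m → M) (j : M →ₗ[WeylAlgebra K n] P) (r : ℕ) :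
    (generatedFiltration K n f r).map (j.restrictScalars K) =
      generatedFiltration K n (fun l => j (f l)) r := by
  rw [generatedFiltration_eq, generatedFiltration_eq]
  exact map_monomialFiltration (K := K) (w := weylMonomialAppend K n) f j r

theorem exists_generates_kernel {i : N →ₗ[WeylAlgebra K n] M} {j : M →ₗ[WeylAlgebra K n] P}
    (hi : Function.Injective i) (hij : Function.Exact i j) {m : ℕ} {f : Fin m → M}
    (hf : Generates K n f) :
    ∃ (t : ℕ) (g : Fin t → N), Generates K n g ∧
      (∀ r, generatedFiltration K n f r ⊓ LinearMap.ker (j.restrictScalars K) ≤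
        generatedFiltration K n (fun l => i (g l)) r) ∧
      ∃ c, ∀ r, generatedFiltration K n (fun l => i (g l)) r ≤
        generatedFiltration K n f (r + c) ⊓ LinearMap.ker (j.restrictScalars K) := by
  have hw := isMonomialFamily_weylMonomialAppend (K := K) (n := n)
  have hf' : Submodule.span (WeylAlgebra K n) (Set.range f) = ⊤ := hf
  obtain ⟨t, g, hg, hker⟩ := hw.exists_ker_inf_monomialFiltration_le f j
  choose g' hg' using fun l => (hij (g l)).1 (hg l)
  obtain rfl : (fun l => i (g' l)) = g := funext hg'
  have hker' : ∀ r, ∀ v ∈ monomialFiltration K (weylMonomialAppend K n) f r, j v = 0 →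
      v ∈ (monomialFiltration K (weylMonomialAppend K n) g' r).map (i.restrictScalars K) := by
    intro r
    have h := map_monomialFiltration (K := K) (w := weylMonomialAppend K n) g' i r
    exact fun v hv hjv => h.ge (hker r v hv hjv)
  refine ⟨t, g', ?_, fun r => ?_, ?_⟩
  · refine eq_top_iff.2 fun v _ => ?_
    -- Each $i(v)$ lies in some $M_r\cap\ker j$, hence in $i(N_r)$; injectivity of $i$ puts $v$ in
    -- the span of `g'`.
    obtain ⟨r, hr⟩ := hw.exists_mem_monomialFiltration span_range_weylMonomialAppend f
      (v := i v) (hf' ▸ Submodule.mem_top)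
    obtain ⟨u, hu, huv⟩ := hker' r _ hr (hij.apply_apply_eq_zero v)
    obtain rfl : u = v := hi huv
    have hle : monomialFiltration K (weylMonomialAppend K n) g' r ≤
        (Submodule.span (WeylAlgebra K n) (Set.range g')).restrictScalars K := by
      refine Submodule.span_le.2 ?_
      rintro _ ⟨b, -, rfl⟩
      exact Submodule.smul_mem _ (weylMonomialAppend K n b.exponent)
        (Submodule.subset_span (Set.mem_range_self b.position))
    exact hle hu
  · rintro v ⟨hv, hjv⟩
    rw [SetLike.mem_coe, generatedFiltration_eq] at hv
    rw [generatedFiltration_eq]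
    exact hker r v hv hjv
  · obtain ⟨c, hc⟩ := hw.exists_monomialFiltration_le span_range_weylMonomialAppend f
      (fun l => i (g' l)) fun _ => hf' ▸ Submodule.mem_top
    refine ⟨c, fun r => le_inf ?_ ?_⟩
    · rw [generatedFiltration_eq, generatedFiltration_eq]
      exact hc r
    · rw [← map_generatedFiltration]
      rintro _ ⟨u, -, rfl⟩
      exact hij.apply_apply_eq_zero u

theorem delta_add_delta [Module.Finite (WeylAlgebra K n) N] [Module.Finite (WeylAlgebra K n) M]
    [Module.Finite (WeylAlgebra K n) P] {i : N →ₗ[WeylAlgebra K n] M}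
    {j : M →ₗ[WeylAlgebra K n] P} (hi : Function.Injective i) (hij : Function.Exact i j)
    (hj : Function.Surjective j) : delta K n N + delta K n P = delta K n M := by
  obtain ⟨m, f, hf⟩ := Module.Finite.exists_fin (R := WeylAlgebra K n) (M := M)
  have hjf : Generates K n (fun l => j (f l)) := by
    have : Set.range (fun l => j (f l)) = j '' Set.range f := Set.range_comp j f
    rw [Generates, this, ← Submodule.map_span, hf, Submodule.map_top, LinearMap.range_eq_top.2 hj]
  obtain ⟨t, g, hg, hle, c, hc⟩ := exists_generates_kernel hi hij hf
  rw [delta_eq hf, delta_eq hg, delta_eq hjf, ← mul_add]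
  congr 1
  obtain ⟨r₁, h₁⟩ := isBernsteinPolynomial_bernsteinDimPoly (K := K) (n := n) f
  obtain ⟨r₂, h₂⟩ := isBernsteinPolynomial_bernsteinDimPoly (K := K) (n := n) g
  obtain ⟨r₃, h₃⟩ := isBernsteinPolynomial_bernsteinDimPoly (K := K) (n := n) fun l => j (f l)
  have df := natDegree_bernsteinDimPoly_le (K := K) (n := n) f
  have dg := natDegree_bernsteinDimPoly_le (K := K) (n := n) g
  have dj := natDegree_bernsteinDimPoly_le (K := K) (n := n) fun l => j (f l)
  have hN : ∀ r, Module.finrank K (generatedFiltration K n (fun l => i (g l)) r) =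
      Module.finrank K (generatedFiltration K n g r) := by
    intro r
    rw [← map_generatedFiltration]
    exact (Submodule.equivMapOfInjective (i.restrictScalars K) hi _).finrank_eq.symm
  have hM : ∀ r, Module.finrank K (generatedFiltration K n (fun l => j (f l)) r) +
      Module.finrank K (generatedFiltration K n f r ⊓ LinearMap.ker (j.restrictScalars K) :
        Submodule K M) = Module.finrank K (generatedFiltration K n f r) := by
    intro r
    rw [← map_generatedFiltration]
    exact finrank_map_add_finrank_ker_inf _ _
  refine le_antisymm ?_ ?_
  -- From $i(N_r)\subseteq M_{r+c}\cap\ker j$: $\dim N_r\le\dim M_{r+c}-\dim P_{r+c}$.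
  · have := coeff_le_coeff_of_eventually_eval_le dg 
      ((natDegree_sub_le_of_le df dj).trans_eq (max_self _)) c
      (r₀ := max r₁ (max r₂ r₃)) fun r hr => by
        rw [eval_sub, h₁ (r + c) (by omega), h₂ r (by omega), h₃ (r + c) (by omega), ← hM, ← hN]
        push_cast
        rw [add_sub_cancel_left]
        exact_mod_cast Submodule.finrank_mono (hc r)
    rw [coeff_sub] at this
    linarith
  -- From $M_r\cap\ker j\subseteq i(N_r)$, without a shift: $\dim M_r\le\dim N_r+\dim P_r$.
  · have := coeff_le_coeff_of_eventually_eval_le df (natDegree_add_le_of_degree_le dg dj) 0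
      (r₀ := max r₁ (max r₂ r₃)) fun r hr => by
        rw [add_zero, eval_add, h₁ r (by omega), h₂ r (by omega), h₃ r (by omega), ← hM, ← hN,
          add_comm]
        push_cast
        gcongr
        exact Submodule.finrank_mono (hle r)
    rwa [coeff_add] at this

end Exact

end Weyl

theorem lemma6p2 (K : Type*) [Field K] (n : ℕ)
    (N M P : Type*)
    [AddCommGroup N] [Module K N] [Module (Weyl.WeylAlgebra K n) N]
    [IsScalarTower K (Weyl.WeylAlgebra K n) N] [Module.Finite (Weyl.WeylAlgebra K n) N]
    [AddCommGroup M] [Module K M] [Module (Weyl.WeylAlgebra K n) M]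
    [IsScalarTower K (Weyl.WeylAlgebra K n) M] [Module.Finite (Weyl.WeylAlgebra K n) M]
    [AddCommGroup P] [Module K P] [Module (Weyl.WeylAlgebra K n) P]
    [IsScalarTower K (Weyl.WeylAlgebra K n) P] [Module.Finite (Weyl.WeylAlgebra K n) P]
    (i : N →ₗ[Weyl.WeylAlgebra K n] M) (j : M →ₗ[Weyl.WeylAlgebra K n] P)
    (hi : Function.Injective i) (hij : Function.Exact i j) (hj : Function.Surjective j) :
    Weyl.DeltaWellDefined K n N (Weyl.delta K n N) ∧
    Weyl.DeltaWellDefined K n M (Weyl.delta K n M) ∧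
    Weyl.DeltaWellDefined K n P (Weyl.delta K n P) ∧
    Weyl.delta K n N + Weyl.delta K n P = Weyl.delta K n M :=
  ⟨Weyl.deltaWellDefined_delta K n N, Weyl.deltaWellDefined_delta K n M,
    Weyl.deltaWellDefined_delta K n P, Weyl.delta_add_delta hi hij hj⟩
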